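/- Let $f_1,f_2:\mathbb R\to\mathbb R$ be smooth with $f_1<f_2$, let $\Omega=\{(x_1,x_2)\in\mathbb R^2: f_1(x_1)<x_2<f_2(x_1)\}$, with unit outer normal $n$ on $\partial\Omega$, and let $\alpha\ge 0$. Let $\partial_\tau n$ be the derivative of $n$ along $\partial\Omega$ with respect to arclength, and put $$\mathfrak c=\frac{\alpha}{\alpha+\|\partial_\tau n\|_{L^\infty(\partial\Omega)}},$$ read as $0$ if $\|\partial_\tau n\|_{L^\infty(\partial\Omega)}=\infty$ or $\alpha=0$. For $a<b$ let $\Omega_{a,b}=\{x\in\Omega: a<x_1<b\}$, and let $\mathcal H_\sigma(\Omega_{a,b})$ be the completion, in the norm of $H^1(\Omega_{a,b})$, of the set of restrictions to $\Omega_{a,b}$ of the vector fields $u\in C^\infty(\overline\Omega;\mathbb R^2)$ with $u=0$ in $\Omega\setminus\Omega_{a,b}$, $u\cdot n=0$ on $\partial\Omega_{a,b}\cap\partial\Omega$ and $\operatorname{div}u=0$ in $\Omega_{a,b}$. Then for all $a<b$ every $v\in\mathcal H_\sigma(\Omega_{a,b})$ has a trace in $L^2(\partial\Omega_{a,b}\cap\partial\Omega)$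 (the continuous extension, in the $H^1$ norm, of the restriction to the walls of fields smooth up to the boundary), and $$\mathfrak c\,\|\nabla v\|_{L^2(\Omega_{a,b})}^2\le 2\,\|D(v)\|_{L^2(\Omega_{a,b})}^2+\alpha\,\|v\|_{L^2(\partial\Omega_{a,b}\cap\partial\Omega)}^2,$$ where $D(v)_{ij}=\tfrac12(\partial_{x_j}v_i+\partial_{x_i}v_j)$, $|A|^2=\sum_{i,j}A_{ij}^2$ for matrices, and the last norm is that of the trace, with respect to arclength. In particular $\mathfrak c$ depends only on $\alpha$ and $\Omega$, not on $a$, $b$ or $v$. -/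

import Mathlib

open MeasureTheory Set Filter Topology
open scoped ENNReal ContDiff

namespace SlipChannel

noncomputable section

/-- Values of planar vector fields, with the Euclidean norm. Points of the plane are written as
pairs `(x₁, x₂) : ℝ × ℝ`, whose volume is two-dimensional Lebesgue measure. -/
abbrev Vec : Type := EuclideanSpace ℝ (Fin 2)

/-- The channel `Ω = {(x₁, x₂) : f₁ x₁ < x₂ < f₂ x₁}`. -/
def channel (f₁ f₂ : ℝ → ℝ) : Set (ℝ × ℝ) :=
  {x | f₁ x.1 < x.2 ∧ x.2 < f₂ x.1}

/-- The truncated channel `Ω_{a,b} = {x ∈ Ω : a < x₁ < b}`. -/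
def truncated (f₁ f₂ : ℝ → ℝ) (a b : ℝ) : Set (ℝ × ℝ) :=
  {x | x ∈ channel f₁ f₂ ∧ a < x.1 ∧ x.1 < b}

/-- Density of arclength of the graph of `f` with respect to `dx₁`. -/
def arclengthDensity (f : ℝ → ℝ) (t : ℝ) : ℝ := Real.sqrt (1 + deriv f t ^ 2)

/-- Unit outer normal of the channel at the point `(t, f₁ t)` of the lower wall. -/
def lowerNormal (f₁ : ℝ → ℝ) (t : ℝ) : Vec :=
  (arclengthDensity f₁ t)⁻¹ • !₂[deriv f₁ t, -1]

/-- Unit outer normal of the channel at the point `(t, f₂ t)` of the upper wall. -/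
def upperNormal (f₂ : ℝ → ℝ) (t : ℝ) : Vec :=
  (arclengthDensity f₂ t)⁻¹ • !₂[-deriv f₂ t, 1]

/-- Derivative with respect to arclength, along the graph of `f`, of a field `n` that is given on
this graph as a function of `x₁`. -/
def tangentialDeriv (f : ℝ → ℝ) (n : ℝ → Vec) (t : ℝ) : Vec :=
  (arclengthDensity f t)⁻¹ • deriv n t

/-- `‖∂_τ n‖_{L^∞(∂Ω)}`, over both (entire) walls; it may be `∞`. Arclength on a wall and `dx₁` have
the same null sets. -/
def normalVariation (f₁ f₂ : ℝ → ℝ) : ℝ≥0∞ :=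
  max (eLpNorm (tangentialDeriv f₁ (lowerNormal f₁)) ∞ volume)
    (eLpNorm (tangentialDeriv f₂ (upperNormal f₂)) ∞ volume)

/-- The constant `𝔠 = α / (α + ‖∂_τ n‖_{L^∞(∂Ω)})`, read as `0` if `‖∂_τ n‖_{L^∞(∂Ω)} = ∞` or
`α = 0`. -/
def kornConst (α : ℝ) (f₁ f₂ : ℝ → ℝ) : ℝ≥0∞ :=
  ENNReal.ofReal α / (ENNReal.ofReal α + normalVariation f₁ f₂)

/-- The arclength measure on the part of the graph of `f` over `(a, b)`. -/
def graphMeasure (f : ℝ → ℝ) (a b : ℝ) : Measure (ℝ × ℝ) :=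
  Measure.map (fun t => (t, f t))
    ((volume.restrict (Ioo a b)).withDensity fun t => ENNReal.ofReal (arclengthDensity f t))

/-- The arclength measure `ds` on the walls `∂Ω_{a,b} ∩ ∂Ω`, which consist of the graphs of `f₁` and
`f₂` over `[a, b]`. -/
def wallMeasure (f₁ f₂ : ℝ → ℝ) (a b : ℝ) : Measure (ℝ × ℝ) :=
  graphMeasure f₁ a b + graphMeasure f₂ a b

/-- The coordinate vectors of the plane. -/
def coordVec : Fin 2 → ℝ × ℝ := ![(1, 0), (0, 1)]

/-- Partial derivative `∂_{x_j} φ`. -/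
def partialDeriv (j : Fin 2) (φ : ℝ × ℝ → ℝ) (x : ℝ × ℝ) : ℝ :=
  fderiv ℝ φ x (coordVec j)

/-- Classical gradient of a vector field, `(∇u)_{ij} = ∂_{x_j} u_i`. -/
def grad (u : ℝ × ℝ → Vec) (x : ℝ × ℝ) : Matrix (Fin 2) (Fin 2) ℝ :=
  Matrix.of fun i j => partialDeriv j (fun y => u y i) x

/-- `D = (A + Aᵀ) / 2`: the strain tensor of a field with gradient `A`. -/
def strain (A : Matrix (Fin 2) (Fin 2) ℝ) : Matrix (Fin 2) (Fin 2) ℝ :=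
  Matrix.of fun i j => (A i j + A j i) / 2

/-- `∫_D |A|² dx` with `|A|² = ∑ A_{ij}²`. -/
def matL2Sq (D : Set (ℝ × ℝ)) (A : ℝ × ℝ → Matrix (Fin 2) (Fin 2) ℝ) : ℝ≥0∞ :=
  ∫⁻ x in D, ∑ i, ∑ j, ‖A x i j‖ₑ ^ 2

/-- `∫ |v|² dμ`. -/
def vecL2Sq (μ : Measure (ℝ × ℝ)) (v : ℝ × ℝ → Vec) : ℝ≥0∞ :=
  ∫⁻ x, ‖v x‖ₑ ^ 2 ∂μ

/-- `v ∈ H¹(D)` and its weak gradient is `G`. -/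
structure HasH1Grad (D : Set (ℝ × ℝ)) (v : ℝ × ℝ → Vec)
    (G : ℝ × ℝ → Matrix (Fin 2) (Fin 2) ℝ) : Prop where
  memLp : MemLp v 2 (volume.restrict D)
  memLp_grad : ∀ i j, MemLp (fun x => G x i j) 2 (volume.restrict D)
  weak : ∀ φ : ℝ × ℝ → ℝ, ContDiff ℝ ∞ φ → HasCompactSupport φ → tsupport φ ⊆ D →
    ∀ i j, ∫ x in D, v x i * partialDeriv j φ x = -∫ x in D, G x i j * φ x

/-- The smooth fields `u n` converge in `H¹(D)` to the field `v` with weak gradient `G`. -/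
def TendstoH1 (D : Set (ℝ × ℝ)) (u : ℕ → ℝ × ℝ → Vec) (v : ℝ × ℝ → Vec)
    (G : ℝ × ℝ → Matrix (Fin 2) (Fin 2) ℝ) : Prop :=
  Tendsto (fun n => vecL2Sq (volume.restrict D) (fun x => u n x - v x) +
    matL2Sq D (fun x => grad (u n) x - G x)) atTop (𝓝 0)

/-- The class `𝒞_σ(Ω_{a,b})`: smooth fields up to the boundary of `Ω` (restrictions of smooth fields
on the plane) that vanish in `Ω \ Ω_{a,b}`, have zero normal component on `∂Ω_{a,b} ∩ ∂Ω`, and are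
divergence free in `Ω_{a,b}`. -/
structure IsCSigma (f₁ f₂ : ℝ → ℝ) (a b : ℝ) (u : ℝ × ℝ → Vec) : Prop where
  smooth : ContDiff ℝ ∞ u
  vanish : ∀ x ∈ channel f₁ f₂ \ truncated f₁ f₂ a b, u x = 0
  lower : ∀ t ∈ Icc a b, inner ℝ (u (t, f₁ t)) (lowerNormal f₁ t) = 0
  upper : ∀ t ∈ Icc a b, inner ℝ (u (t, f₂ t)) (upperNormal f₂ t) = 0
  divFree : ∀ x ∈ truncated f₁ f₂ a b, ∑ i, grad u x i i = 0

/-- `v ∈ ℋ_σ(Ω_{a,b})`: the completion of `𝒞_σ(Ω_{a,b})` in the `H¹` norm, realized as its closure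
in `H¹(Ω_{a,b})`. -/
def MemHSigma (f₁ f₂ : ℝ → ℝ) (a b : ℝ) (v : ℝ × ℝ → Vec) : Prop :=
  ∃ G, HasH1Grad (truncated f₁ f₂ a b) v G ∧
    ∃ u : ℕ → ℝ × ℝ → Vec, (∀ n, IsCSigma f₁ f₂ a b (u n)) ∧
      TendstoH1 (truncated f₁ f₂ a b) u v G

/-- `g` is the trace on the walls `∂Ω_{a,b} ∩ ∂Ω` of `v ∈ H¹(Ω_{a,b})`: the continuous extension of
the restriction to the walls from fields that are smooth up to the boundary. -/
def IsWallTrace (f₁ f₂ : ℝ → ℝ) (a b : ℝ) (v g : ℝ × ℝ → Vec) : Prop :=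
  MemLp g 2 (wallMeasure f₁ f₂ a b) ∧
    ∃ G, HasH1Grad (truncated f₁ f₂ a b) v G ∧
      ∃ u : ℕ → ℝ × ℝ → Vec, (∀ n, ContDiff ℝ ∞ (u n)) ∧
        TendstoH1 (truncated f₁ f₂ a b) u v G ∧
        Tendsto (fun n => vecL2Sq (wallMeasure f₁ f₂ a b) (fun x => u n x - g x)) atTop (𝓝 0)

end

end SlipChannel

open SlipChannel

/-! For a planar matrix `A` with symmetric part `D`, `2|D|² = |A|² + ∑ A_ij A_ji`. So for smooth `u`
the estimate reduces to controlling the integral of the cross terms `∑ ∂_j u_i ∂_i u_j`. When `div u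
= 0`, this sum is the divergence of the advection field `(u · ∇)u` (`divergence_advection`), so its
integral is a boundary flux. The flux through the sides `x₁ = a, b` vanishes because `u` does. On a
wall, differentiating the tangency `u · n = 0` along the wall turns the flux into `± u₁² f'' dx₁`
(`advection_flux`), which contains no derivative of `u`.

The curvature of a graph satisfies `|f''| ≤ |∂_τ n| ρ³` with `ρ = √(1 + f'²)`, while tangency gives
`|u|² = ρ² u₁²`. The wall terms are therefore at most `‖∂_τ n‖_∞ ∫ |u|² ds`, which gives `‖∇u‖² ≤
2‖D(u)‖² + ‖∂_τ n‖_∞ ‖u‖²` (`IsCSigma.matL2Sq_grad_le`). Multiplying by `𝔠`, with `𝔠 ≤ 1` and `𝔠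
‖∂_τ n‖_∞ ≤ α`, proves the claim for smooth fields, now with finite coefficients only.

The general case follows by density. A trace inequality on vertical segments
(`exists_vecL2Sq_wallMeasure_le`) makes the wall restrictions of an `H¹`-convergent sequence Cauchy
in `L²`, so the trace exists and is reached along every approximating sequence; all three terms then
pass to the limit. -/

namespace SlipChannel

/-! ### Divergence theorem between two graphs -/

/-- The divergence theorem on the region between two graphs. -/
theorem integral_divergence_between_graphs {F₁ F₂ : ℝ × ℝ → ℝ} {f₁ f₂ : ℝ → ℝ}
    (hF₁ : ContDiff ℝ ∞ F₁) (hF₂ : ContDiff ℝ ∞ F₂) (hf₁ : ContDiff ℝ ∞ f₁)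
    (hf₂ : ContDiff ℝ ∞ f₂) (a b : ℝ) :
    ∫ t in a..b, ∫ y in f₁ t..f₂ t, (fderiv ℝ F₁ (t, y) (1, 0) + fderiv ℝ F₂ (t, y) (0, 1)) =
      (∫ t in a..b, (F₂ (t, f₂ t) - deriv f₂ t * F₁ (t, f₂ t))) -
      (∫ t in a..b, (F₂ (t, f₁ t) - deriv f₁ t * F₁ (t, f₁ t))) +
      (∫ y in f₁ b..f₂ b, F₁ (b, y)) - ∫ y in f₁ a..f₂ a, F₁ (a, y) := by
  have hd₁ : ContDiff ℝ ∞ (deriv f₁) := by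
    simpa using hf₁.iterate_deriv 1
  have hd₂ : ContDiff ℝ ∞ (deriv f₂) := by
    simpa using hf₂.iterate_deriv 1
  -- `ψ` maps the strip `0 ≤ s ≤ 1` onto the region, and `(A, B)` is the Piola transform of `(F₁,
  -- F₂)` under `ψ`: its divergence is the Jacobian `f₂ - f₁` times the pulled-back divergence. The
  -- divergence theorem on a rectangle then suffices.
  set ψ : ℝ × ℝ → ℝ × ℝ := fun p => (p.1, f₁ p.1 + (f₂ p.1 - f₁ p.1) * p.2) with hψ
  have hψs : ContDiff ℝ ∞ ψ := by fun_prop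
  set A : ℝ × ℝ → ℝ := fun p => (f₂ p.1 - f₁ p.1) * F₁ (ψ p) with hA
  set B : ℝ × ℝ → ℝ := fun p =>
    F₂ (ψ p) - (deriv f₁ p.1 + (deriv f₂ p.1 - deriv f₁ p.1) * p.2) * F₁ (ψ p) with hB
  have hAs : ContDiff ℝ ∞ A := by fun_prop
  have hBs : ContDiff ℝ ∞ B := by fun_prop
  have hAc := hAs.continuous_fderiv (by simp)
  have hBc := hBs.continuous_fderiv (by simp)
  have key := integral2_divergence_prod_of_hasFDerivAt A B (fderiv ℝ A) (fderiv ℝ B) a 0 b 1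
    hAs.continuous.continuousOn hBs.continuous.continuousOn
    (fun x _ => (hAs.differentiable (by simp) x).hasFDerivAt)
    (fun x _ => (hBs.differentiable (by simp) x).hasFDerivAt)
    (ContinuousOn.integrableOn_compact (isCompact_uIcc.prod isCompact_uIcc)
      (by fun_prop))
  have hdiv : ∀ p : ℝ × ℝ, fderiv ℝ A p (1, 0) + fderiv ℝ B p (0, 1) =
      (f₂ p.1 - f₁ p.1) * (fderiv ℝ F₁ (ψ p) (1, 0) + fderiv ℝ F₂ (ψ p) (0, 1)) := by
    intro p
    have efst : HasFDerivAt (fun q : ℝ × ℝ => q.1) (ContinuousLinearMap.fst ℝ ℝ ℝ) p :=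
      hasFDerivAt_fst
    have esnd : HasFDerivAt (fun q : ℝ × ℝ => q.2) (ContinuousLinearMap.snd ℝ ℝ ℝ) p :=
      hasFDerivAt_snd
    have e₁ : HasFDerivAt (fun p : ℝ × ℝ => f₁ p.1) _ p :=
      ((hf₁.differentiable (by simp) p.1).hasDerivAt.comp_hasFDerivAt p efst)
    have e₂ : HasFDerivAt (fun p : ℝ × ℝ => f₂ p.1) _ p :=
      ((hf₂.differentiable (by simp) p.1).hasDerivAt.comp_hasFDerivAt p efst)
    have e₃ : HasFDerivAt (fun p : ℝ × ℝ => deriv f₁ p.1) _ p :=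
      ((hd₁.differentiable (by simp) p.1).hasDerivAt.comp_hasFDerivAt p efst)
    have e₄ : HasFDerivAt (fun p : ℝ × ℝ => deriv f₂ p.1) _ p :=
      ((hd₂.differentiable (by simp) p.1).hasDerivAt.comp_hasFDerivAt p efst)
    have e₅ : HasFDerivAt ψ _ p :=
      efst.prodMk (e₁.add ((e₂.sub e₁).mul esnd))
    have e₆ : HasFDerivAt (fun p => F₁ (ψ p)) _ p :=
      ((hF₁.differentiable (by simp) (ψ p)).hasFDerivAt.comp p e₅)
    have e₇ : HasFDerivAt (fun p => F₂ (ψ p)) _ p :=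
      ((hF₂.differentiable (by simp) (ψ p)).hasFDerivAt.comp p e₅)
    have eA : HasFDerivAt A _ p := (e₂.sub e₁).mul e₆
    have eB : HasFDerivAt B _ p :=
      e₇.sub ((e₃.add ((e₄.sub e₃).mul esnd)).mul e₆)
    rw [eA.fderiv, eB.fderiv]
    have split : ∀ (T : ℝ × ℝ →L[ℝ] ℝ) (x y : ℝ), T (x, y) = x * T (1, 0) + y * T (0, 1) := by
      intro T x y
      have : ((x, y) : ℝ × ℝ) = x • (1, 0) + y • (0, 1) := by simp
      rw [this, map_add, map_smul, map_smul, smul_eq_mul, smul_eq_mul]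
    simp
    rw [split (fderiv ℝ F₁ (ψ p)) 1 _, split (fderiv ℝ F₁ (ψ p)) 0 (f₂ p.1 - f₁ p.1),
      split (fderiv ℝ F₂ (ψ p)) 0 (f₂ p.1 - f₁ p.1)]
    ring
  have scale : ∀ (g : ℝ → ℝ) (t : ℝ), ∫ s in (0 : ℝ)..1,
      (f₂ t - f₁ t) * g (f₁ t + (f₂ t - f₁ t) * s) = ∫ y in f₁ t..f₂ t, g y := by
    intro g t
    rw [intervalIntegral.integral_const_mul]
    simp
  simp only [hdiv] at key
  simp only [hψ, hA, hB] at key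
  rw [scale (fun y => F₁ (b, y)), scale (fun y => F₁ (a, y))] at key
  simp only [mul_one, mul_zero, add_sub_cancel, add_zero] at key
  rw [← key]
  refine intervalIntegral.integral_congr fun t _ => ?_
  exact (scale (fun y => fderiv ℝ F₁ (t, y) (1, 0) + fderiv ℝ F₂ (t, y) (0, 1)) t).symm

/-! ### Topology of the truncated channel and iterated integrals over it -/

theorem truncated_eq_regionBetween (f₁ f₂ : ℝ → ℝ) (a b : ℝ) :
    truncated f₁ f₂ a b = regionBetween f₁ f₂ (Ioo a b) := by
  ext x
  simp only [truncated, channel, regionBetween, mem_ofPred_eq, mem_Ioo]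
  tauto

theorem measurableSet_truncated {f₁ f₂ : ℝ → ℝ} (hf₁ : Continuous f₁) (hf₂ : Continuous f₂)
    (a b : ℝ) : MeasurableSet (truncated f₁ f₂ a b) := by
  rw [truncated_eq_regionBetween]
  exact measurableSet_regionBetween hf₁.measurable hf₂.measurable measurableSet_Ioo

theorem isOpen_truncated {f₁ f₂ : ℝ → ℝ} (hf₁ : Continuous f₁) (hf₂ : Continuous f₂)
    (a b : ℝ) : IsOpen (truncated f₁ f₂ a b) := by
  have h₁ : IsOpen {x : ℝ × ℝ | f₁ x.1 < x.2} := isOpen_lt (by fun_prop) (by fun_prop)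
  have h₂ : IsOpen {x : ℝ × ℝ | x.2 < f₂ x.1} := isOpen_lt (by fun_prop) (by fun_prop)
  have h₃ : IsOpen {x : ℝ × ℝ | a < x.1} := isOpen_lt (by fun_prop) (by fun_prop)
  have h₄ : IsOpen {x : ℝ × ℝ | x.1 < b} := isOpen_lt (by fun_prop) (by fun_prop)
  exact (h₁.inter h₂).inter (h₃.inter h₄)

theorem exists_isCompact_superset_truncated {f₁ f₂ : ℝ → ℝ} (hf₁ : Continuous f₁)
    (hf₂ : Continuous f₂) (a b : ℝ) : ∃ K, IsCompact K ∧ truncated f₁ f₂ a b ⊆ K := by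
  obtain ⟨m, hm⟩ := (isCompact_Icc.image_of_continuousOn
    (hf₁.continuousOn (s := Icc a b))).bddBelow
  obtain ⟨M, hM⟩ := (isCompact_Icc.image_of_continuousOn
    (hf₂.continuousOn (s := Icc a b))).bddAbove
  refine ⟨Icc a b ×ˢ Icc m M, isCompact_Icc.prod isCompact_Icc, ?_⟩
  rintro ⟨t, y⟩ ⟨⟨h₁, h₂⟩, h₃, h₄⟩
  have ht : t ∈ Icc a b := ⟨h₃.le, h₄.le⟩
  exact ⟨ht, (hm (mem_image_of_mem _ ht)).trans h₁.le, h₂.le.trans (hM (mem_image_of_mem _ ht))⟩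

theorem integrableOn_truncated {f₁ f₂ : ℝ → ℝ} (hf₁ : Continuous f₁)
    (hf₂ : Continuous f₂) (a b : ℝ) {g : ℝ × ℝ → ℝ} (hg : Continuous g) :
    IntegrableOn g (truncated f₁ f₂ a b) := by
  obtain ⟨K, hK, hsub⟩ := exists_isCompact_superset_truncated hf₁ hf₂ a b
  exact (hg.continuousOn.integrableOn_compact hK).mono_set hsub

theorem setLIntegral_truncated {f₁ f₂ : ℝ → ℝ} (hf₁ : Continuous f₁) (hf₂ : Continuous f₂)
    (a b : ℝ) {g : ℝ × ℝ → ℝ≥0∞} (hg : Measurable g) :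
    ∫⁻ x in truncated f₁ f₂ a b, g x =
      ∫⁻ t in Ioo a b, ∫⁻ y in Ioo (f₁ t) (f₂ t), g (t, y) := by
  have hD := measurableSet_truncated hf₁ hf₂ a b
  rw [← lintegral_indicator hD, Measure.volume_eq_prod,
    lintegral_prod _ (hg.indicator hD).aemeasurable, ← lintegral_indicator measurableSet_Ioo]
  refine lintegral_congr fun t => ?_
  by_cases ht : t ∈ Ioo a b
  · rw [indicator_of_mem ht, ← lintegral_indicator measurableSet_Ioo]
    refine lintegral_congr fun y => ?_
    by_cases hy : y ∈ Ioo (f₁ t) (f₂ t)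
    · rw [indicator_of_mem hy, indicator_of_mem]
      exact ⟨hy, ht⟩
    · rw [indicator_of_notMem hy, indicator_of_notMem]
      exact fun h => hy h.1
  · rw [indicator_of_notMem ht]
    have : ∀ y, (truncated f₁ f₂ a b).indicator g (t, y) = 0 := fun y =>
      indicator_of_notMem (fun h => ht h.2) _
    simp [this]

theorem setIntegral_truncated {f₁ f₂ : ℝ → ℝ} (hf₁ : Continuous f₁) (hf₂ : Continuous f₂)
    (hlt : ∀ t, f₁ t < f₂ t) {a b : ℝ} (hab : a < b) {g : ℝ × ℝ → ℝ} (hg : Continuous g) :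
    ∫ x in truncated f₁ f₂ a b, g x = ∫ t in a..b, ∫ y in f₁ t..f₂ t, g (t, y) := by
  have hD := measurableSet_truncated hf₁ hf₂ a b
  rw [← integral_indicator hD, Measure.volume_eq_prod, integral_prod _
    ((integrable_indicator_iff hD).2 (integrableOn_truncated hf₁ hf₂ a b hg)),
    intervalIntegral.integral_of_le hab.le, ← integral_Ioc_eq_integral_Ioo.symm,
    ← integral_indicator measurableSet_Ioo]
  refine integral_congr_ae (Eventually.of_forall fun t => ?_)
  by_cases ht : t ∈ Ioo a b
  · simp only [indicator_of_mem ht]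
    rw [intervalIntegral.integral_of_le (hlt t).le, ← integral_Ioc_eq_integral_Ioo.symm,
      ← integral_indicator measurableSet_Ioo]
    refine integral_congr_ae (Eventually.of_forall fun y => ?_)
    by_cases hy : y ∈ Ioo (f₁ t) (f₂ t)
    · simp only [indicator_of_mem hy]
      exact indicator_of_mem (show (t, y) ∈ truncated f₁ f₂ a b from ⟨hy, ht⟩) g
    · simp only [indicator_of_notMem hy]
      exact indicator_of_notMem (fun h => hy h.1) _
  · have : ∀ y, (truncated f₁ f₂ a b).indicator g (t, y) = 0 := fun y =>
      indicator_of_notMem (fun h => ht h.2) _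
    simp [this, indicator_of_notMem ht]

/-! ### Divergence and wall flux of the advection field -/

theorem hasFDerivAt_fderiv_apply {p : ℝ × ℝ → ℝ} (hp : ContDiff ℝ ∞ p) (v x : ℝ × ℝ) :
    HasFDerivAt (fun y => fderiv ℝ p y v) ((fderiv ℝ (fderiv ℝ p) x).flip v) x := by
  have h : ContDiff ℝ ∞ (fderiv ℝ p) := hp.fderiv_right (by simp)
  have := (h.differentiable (by simp) x).hasFDerivAt.clm_apply (hasFDerivAt_const v x)
  refine this.congr_fderiv ?_
  simp

theorem contDiff_fderiv_apply {p : ℝ × ℝ → ℝ} (hp : ContDiff ℝ ∞ p) (v : ℝ × ℝ) :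
    ContDiff ℝ ∞ (fun y => fderiv ℝ p y v) :=
  (hp.fderiv_right (m := ∞) (by simp)).clm_apply contDiff_const

theorem fderiv_fderiv_comm {p : ℝ × ℝ → ℝ} (hp : ContDiff ℝ ∞ p) (x v w : ℝ × ℝ) :
    fderiv ℝ (fderiv ℝ p) x v w = fderiv ℝ (fderiv ℝ p) x w v :=
  (hp.contDiffAt (x := x)).isSymmSndFDerivAt (by
    rw [minSmoothness_of_isRCLikeNormedField]
    exact WithTop.coe_le_coe.2 le_top) v w

/-- The divergence of the advection field `(w · ∇) w` of a solenoidal planar field `w = (p, q)`. -/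
theorem divergence_advection {p q : ℝ × ℝ → ℝ} (hp : ContDiff ℝ ∞ p) (hq : ContDiff ℝ ∞ q)
    {x : ℝ × ℝ} (h : ∀ᶠ y in 𝓝 x, fderiv ℝ p y (1, 0) + fderiv ℝ q y (0, 1) = 0) :
    fderiv ℝ (fun y => p y * fderiv ℝ p y (1, 0) + q y * fderiv ℝ p y (0, 1)) x (1, 0) +
      fderiv ℝ (fun y => p y * fderiv ℝ q y (1, 0) + q y * fderiv ℝ q y (0, 1)) x (0, 1) =
      fderiv ℝ p x (1, 0) ^ 2 + 2 * (fderiv ℝ p x (0, 1) * fderiv ℝ q x (1, 0)) +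
        fderiv ℝ q x (0, 1) ^ 2 := by
  have hp' := (hp.differentiable (by simp) x).hasFDerivAt
  have hq' := (hq.differentiable (by simp) x).hasFDerivAt
  have hdiv : HasFDerivAt (fun y => fderiv ℝ p y (1, 0) + fderiv ℝ q y (0, 1)) _ x :=
    (hasFDerivAt_fderiv_apply hp (1, 0) x).add (hasFDerivAt_fderiv_apply hq (0, 1) x)
  -- The divergence vanishes near `x`, not only at `x`, so its gradient vanishes at `x` as well.
  have hzero := hdiv.unique
    ((hasFDerivAt_const (0 : ℝ) x).congr_of_eventuallyEq (h : _ =ᶠ[𝓝 x] fun _ => (0 : ℝ)))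
  have hx := DFunLike.congr_fun hzero (1, 0)
  have hy := DFunLike.congr_fun hzero (0, 1)
  have e₁ : HasFDerivAt (fun y => p y * fderiv ℝ p y (1, 0) + q y * fderiv ℝ p y (0, 1)) _ x :=
    (hp'.mul (hasFDerivAt_fderiv_apply hp (1, 0) x)).add
      (hq'.mul (hasFDerivAt_fderiv_apply hp (0, 1) x))
  have e₂ : HasFDerivAt (fun y => p y * fderiv ℝ q y (1, 0) + q y * fderiv ℝ q y (0, 1)) _ x :=
    (hp'.mul (hasFDerivAt_fderiv_apply hq (1, 0) x)).add
      (hq'.mul (hasFDerivAt_fderiv_apply hq (0, 1) x))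
  rw [e₁.fderiv, e₂.fderiv]
  simp only [add_apply, smul_apply,
    ContinuousLinearMap.flip_apply, zero_apply, smul_eq_mul] at hx hy ⊢
  have s₁ := fderiv_fderiv_comm hp x (1, 0) (0, 1)
  have s₂ := fderiv_fderiv_comm hq x (1, 0) (0, 1)
  rw [s₁]
  rw [← s₂]
  -- In general `div((w · ∇)w) = ∑ ∂_j w_i ∂_i w_j + w · ∇(div w)`; the last term is removed here.
  linear_combination p x * hx + q x * hy

/-- Flux of the advection field of `(p, q)` through a graph to which `(p, q)` is tangent. -/
theorem advection_flux {p q : ℝ × ℝ → ℝ} (hp : ContDiff ℝ ∞ p) (hq : ContDiff ℝ ∞ q)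
    {f : ℝ → ℝ} (hf : ContDiff ℝ ∞ f) {t : ℝ}
    (h : ∀ᶠ s in 𝓝 t, q (s, f s) = deriv f s * p (s, f s)) :
    (p (t, f t) * fderiv ℝ q (t, f t) (1, 0) + q (t, f t) * fderiv ℝ q (t, f t) (0, 1)) -
      deriv f t *
        (p (t, f t) * fderiv ℝ p (t, f t) (1, 0) + q (t, f t) * fderiv ℝ p (t, f t) (0, 1)) =
      p (t, f t) ^ 2 * deriv (deriv f) t := by
  have hd : ContDiff ℝ ∞ (deriv f) := by
    simpa using hf.iterate_deriv 1
  have hg : HasDerivAt (fun s => (s, f s)) ((1 : ℝ), deriv f t) t :=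
    (hasDerivAt_id t).prodMk (hf.differentiable (by simp) t).hasDerivAt
  have e₁ : HasDerivAt (fun s => p (s, f s)) _ t :=
    (hp.differentiable (by simp) (t, f t)).hasFDerivAt.comp_hasDerivAt t hg
  have e₂ : HasDerivAt (fun s => q (s, f s)) _ t :=
    (hq.differentiable (by simp) (t, f t)).hasFDerivAt.comp_hasDerivAt t hg
  have e₃ : HasDerivAt (fun s => deriv f s * p (s, f s)) _ t :=
    (hd.differentiable (by simp) t).hasDerivAt.mul e₁
  -- Tangency holds along the graph near `t`, so it may be differentiated there; this is where `f''`
  -- enters.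
  have key := e₂.unique (e₃.congr_of_eventuallyEq h)
  have split : ∀ (T : ℝ × ℝ →L[ℝ] ℝ) (y : ℝ), T (1, y) = T (1, 0) + y * T (0, 1) := by
    intro T y
    have : ((1, y) : ℝ × ℝ) = (1, 0) + y • (0, 1) := by simp
    rw [this, map_add, map_smul, smul_eq_mul]
  simp only [split _ (deriv f t)] at key
  rw [h.self_of_nhds]
  linear_combination p (t, f t) * key

/-! ### Curvature of a graph and the derivative of its normal -/

theorem arclengthDensity_pos (f : ℝ → ℝ) (t : ℝ) : 0 < arclengthDensity f t :=
  Real.sqrt_pos.2 (by positivity)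

theorem arclengthDensity_sq (f : ℝ → ℝ) (t : ℝ) :
    arclengthDensity f t ^ 2 = 1 + deriv f t ^ 2 :=
  Real.sq_sqrt (by positivity)

theorem continuous_arclengthDensity {f : ℝ → ℝ} (hf : ContDiff ℝ ∞ f) :
    Continuous (arclengthDensity f) := by
  have := hf.continuous_deriv (by simp)
  unfold arclengthDensity
  fun_prop

/-- Differentiating the orthogonality of `n` and `(1, f')` gives `n' · (1, f') = f'' / ρ`. Since
`|(1, f')| = ρ`, Cauchy–Schwarz bounds this by `ρ |n'| = ρ² |∂_τ n|`. -/
theorem abs_deriv_deriv_le {f : ℝ → ℝ} (hf : ContDiff ℝ ∞ f) (t : ℝ) :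
    |deriv (deriv f) t| ≤
      ‖tangentialDeriv f (lowerNormal f) t‖ * arclengthDensity f t ^ 3 := by
  have hd : ContDiff ℝ ∞ (deriv f) := by
    simpa using hf.iterate_deriv 1
  have hdd := hd.differentiable (by simp)
  have hρ := arclengthDensity_pos f t
  have hρd : DifferentiableAt ℝ (arclengthDensity f) t := by
    unfold arclengthDensity
    have : (1 : ℝ) + deriv f t ^ 2 ≠ 0 := by positivity
    fun_prop (disch := assumption)
  have hv : DifferentiableAt ℝ (fun s => (!₂[deriv f s, -1] : Vec)) t := by
    rw [differentiableAt_euclidean]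
    intro i
    fin_cases i
    · simpa using hdd t
    · simp
  have hn : DifferentiableAt ℝ (lowerNormal f) t := by
    unfold lowerNormal
    exact (hρd.inv hρ.ne').smul hv
  have hτ : HasDerivAt (fun s => (!₂[1, deriv f s] : Vec)) !₂[0, deriv (deriv f) t] t := by
    have h := ((hdd t).hasDerivAt.smul_const (!₂[0, 1] : Vec)).const_add (!₂[1, 0] : Vec)
    have h₁ : ∀ c : ℝ, c • (!₂[0, 1] : Vec) = !₂[0, c] := by
      intro c
      ext i
      fin_cases i <;> simp
    have h₂ : ∀ c : ℝ, (!₂[1, 0] : Vec) + !₂[0, c] = !₂[1, c] := by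
      intro c
      ext i
      fin_cases i <;> simp
    simpa only [h₁, h₂] using h
  have horth : ∀ s, inner ℝ (lowerNormal f s) (!₂[1, deriv f s] : Vec) = 0 := by
    intro s
    simp [lowerNormal, inner_smul_left, PiLp.inner_apply]
  have hprod := hn.hasDerivAt.inner ℝ hτ
  have hzero := hprod.unique (by simpa only [horth] using hasDerivAt_const t (0 : ℝ))
  have h₁ : inner ℝ (lowerNormal f t) (!₂[0, deriv (deriv f) t] : Vec) =
      -((arclengthDensity f t)⁻¹ * deriv (deriv f) t) := by
    simp [lowerNormal, inner_smul_left, PiLp.inner_apply]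
  have hnorm : ‖(!₂[1, deriv f t] : Vec)‖ = arclengthDensity f t := by
    simp [EuclideanSpace.norm_eq, arclengthDensity]
  have hcs := abs_real_inner_le_norm (deriv (lowerNormal f) t) (!₂[1, deriv f t] : Vec)
  have h₂ : inner ℝ (deriv (lowerNormal f) t) (!₂[1, deriv f t] : Vec) =
      (arclengthDensity f t)⁻¹ * deriv (deriv f) t := by linarith
  rw [h₂, hnorm, abs_mul, abs_of_pos (inv_pos.2 hρ), inv_mul_le_iff₀ hρ] at hcs
  rw [tangentialDeriv, norm_smul, Real.norm_of_nonneg (inv_pos.2 hρ).le]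
  refine hcs.trans (le_of_eq ?_)
  field_simp

/-- On one and the same graph the two normals are opposite, so the curvature bounds need only one of
them. -/
theorem norm_tangentialDeriv_upperNormal (f : ℝ → ℝ) (t : ℝ) :
    ‖tangentialDeriv f (upperNormal f) t‖ = ‖tangentialDeriv f (lowerNormal f) t‖ := by
  have : upperNormal f = -lowerNormal f := by
    funext s
    ext i
    fin_cases i <;> simp [upperNormal, lowerNormal]
  rw [tangentialDeriv, tangentialDeriv, this, deriv.neg, smul_neg, norm_neg]

theorem inner_lowerNormal_eq_zero_iff (f : ℝ → ℝ) (t : ℝ) (w : Vec) :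
    inner ℝ w (lowerNormal f t) = 0 ↔ w 1 = deriv f t * w 0 := by
  have hρ := (inv_pos.2 (arclengthDensity_pos f t)).ne'
  simp only [lowerNormal, inner_smul_right, mul_eq_zero, hρ, false_or]
  simp [PiLp.inner_apply]
  constructor <;> intro h <;> linarith

theorem inner_upperNormal_eq_zero_iff (f : ℝ → ℝ) (t : ℝ) (w : Vec) :
    inner ℝ w (upperNormal f t) = 0 ↔ w 1 = deriv f t * w 0 := by
  have hρ := (inv_pos.2 (arclengthDensity_pos f t)).ne'
  simp only [upperNormal, inner_smul_right, mul_eq_zero, hρ, false_or]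
  simp [PiLp.inner_apply]
  constructor <;> intro h <;> linarith

/-- The curvature term of the flux on a wall is controlled by `‖∂_τ n‖ |w|² ds`. -/
theorem sq_mul_abs_deriv_deriv_le {f : ℝ → ℝ} (hf : ContDiff ℝ ∞ f) (t : ℝ) (w : Vec)
    (hw : w 1 = deriv f t * w 0) :
    w 0 ^ 2 * |deriv (deriv f) t| ≤
      ‖tangentialDeriv f (lowerNormal f) t‖ * (arclengthDensity f t * ‖w‖ ^ 2) := by
  have h₁ := mul_le_mul_of_nonneg_left (abs_deriv_deriv_le hf t) (sq_nonneg (w 0))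
  refine h₁.trans (le_of_eq ?_)
  have : ‖w‖ ^ 2 = w 0 ^ 2 * arclengthDensity f t ^ 2 := by
    rw [EuclideanSpace.real_norm_sq_eq, arclengthDensity_sq, Fin.sum_univ_two, hw]
    ring
  rw [this]
  ring

/-! ### Extended nonnegative integrals of smooth fields -/

theorem lintegral_graphMeasure {f : ℝ → ℝ} (hf : ContDiff ℝ ∞ f) (a b : ℝ)
    {g : ℝ × ℝ → ℝ≥0∞} (hg : Measurable g) :
    ∫⁻ x, g x ∂graphMeasure f a b =
      ∫⁻ t in Ioo a b, ENNReal.ofReal (arclengthDensity f t) * g (t, f t) := by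
  have hm : Measurable fun t => (t, f t) := by
    have := hf.continuous.measurable
    fun_prop
  have hρ : Measurable fun t => ENNReal.ofReal (arclengthDensity f t) :=
    (continuous_arclengthDensity hf).measurable.ennreal_ofReal
  rw [graphMeasure, lintegral_map hg hm]
  exact lintegral_withDensity_eq_lintegral_mul _ hρ (hg.comp hm)

theorem enorm_sq_eq_ofReal (c : ℝ) : ‖c‖ₑ ^ 2 = ENNReal.ofReal (c ^ 2) := by
  rw [Real.enorm_eq_ofReal_abs, ← ENNReal.ofReal_pow (abs_nonneg c), sq_abs]

theorem enorm_sq_eq_ofReal_norm_sq (w : Vec) : ‖w‖ₑ ^ 2 = ENNReal.ofReal (‖w‖ ^ 2) := by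
  rw [← ofReal_norm, ENNReal.ofReal_pow (norm_nonneg w)]

theorem sum_enorm_sq_eq_ofReal (A : Matrix (Fin 2) (Fin 2) ℝ) :
    ∑ i, ∑ j, ‖A i j‖ₑ ^ 2 = ENNReal.ofReal (∑ i, ∑ j, A i j ^ 2) := by
  simp only [Fin.sum_univ_two, enorm_sq_eq_ofReal]
  rw [ENNReal.ofReal_add (by positivity) (by positivity),
    ENNReal.ofReal_add (by positivity) (by positivity),
    ENNReal.ofReal_add (by positivity) (by positivity)]

theorem contDiff_component {u : ℝ × ℝ → Vec} (hu : ContDiff ℝ ∞ u) (i : Fin 2) :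
    ContDiff ℝ ∞ fun x => u x i :=
  contDiff_euclidean.1 hu i

theorem continuous_grad_apply {u : ℝ × ℝ → Vec} (hu : ContDiff ℝ ∞ u) (i j : Fin 2) :
    Continuous fun x => grad u x i j :=
  (contDiff_fderiv_apply (contDiff_component hu i) (coordVec j)).continuous

theorem matL2Sq_eq_ofReal {f₁ f₂ : ℝ → ℝ} (hf₁ : Continuous f₁) (hf₂ : Continuous f₂) (a b : ℝ)
    {A : ℝ × ℝ → Matrix (Fin 2) (Fin 2) ℝ} (hA : ∀ i j, Continuous fun x => A x i j) :
    matL2Sq (truncated f₁ f₂ a b) A =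
      ENNReal.ofReal (∫ x in truncated f₁ f₂ a b, ∑ i, ∑ j, A x i j ^ 2) := by
  rw [matL2Sq, ofReal_integral_eq_lintegral_ofReal]
  · exact lintegral_congr fun x => sum_enorm_sq_eq_ofReal (A x)
  · exact integrableOn_truncated hf₁ hf₂ a b (by fun_prop)
  · exact Eventually.of_forall fun x => Finset.sum_nonneg fun i _ => Finset.sum_nonneg fun j _ =>
      sq_nonneg _

/-! ### Korn inequality for smooth solenoidal fields -/

/-- The flux identity: for solenoidal fields tangent to the walls, the integral of
`∑ ∂_j u_i ∂_i u_j` reduces to curvature terms on the walls. -/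
theorem integral_cross_terms {f₁ f₂ : ℝ → ℝ} (hf₁ : ContDiff ℝ ∞ f₁) (hf₂ : ContDiff ℝ ∞ f₂)
    (hlt : ∀ t, f₁ t < f₂ t) {a b : ℝ} (hab : a < b) {u : ℝ × ℝ → Vec}
    (hu : IsCSigma f₁ f₂ a b u) :
    ∫ x in truncated f₁ f₂ a b, ∑ i, ∑ j, grad u x i j * grad u x j i =
      (∫ t in a..b, u (t, f₂ t) 0 ^ 2 * deriv (deriv f₂) t) -
        ∫ t in a..b, u (t, f₁ t) 0 ^ 2 * deriv (deriv f₁) t := by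
  set p : ℝ × ℝ → ℝ := fun x => u x 0 with hp
  set q : ℝ × ℝ → ℝ := fun x => u x 1 with hq
  have hps : ContDiff ℝ ∞ p := contDiff_component hu.smooth 0
  have hqs : ContDiff ℝ ∞ q := contDiff_component hu.smooth 1
  have hpx := contDiff_fderiv_apply hps (1, 0)
  have hpy := contDiff_fderiv_apply hps (0, 1)
  have hqx := contDiff_fderiv_apply hqs (1, 0)
  have hqy := contDiff_fderiv_apply hqs (0, 1)
  set F : ℝ × ℝ → ℝ := fun y => p y * fderiv ℝ p y (1, 0) + q y * fderiv ℝ p y (0, 1) with hF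
  set H : ℝ × ℝ → ℝ := fun y => p y * fderiv ℝ q y (1, 0) + q y * fderiv ℝ q y (0, 1) with hH
  have hFs : ContDiff ℝ ∞ F := by fun_prop
  have hHs : ContDiff ℝ ∞ H := by fun_prop
  have hdiv : ∀ x ∈ truncated f₁ f₂ a b, fderiv ℝ F x (1, 0) + fderiv ℝ H x (0, 1) =
      ∑ i, ∑ j, grad u x i j * grad u x j i := by
    intro x hx
    have hev : ∀ᶠ y in 𝓝 x, fderiv ℝ p y (1, 0) + fderiv ℝ q y (0, 1) = 0 := by
      filter_upwards [(isOpen_truncated hf₁.continuous hf₂.continuous a b).mem_nhds hx] with y hy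
      have := hu.divFree y hy
      rwa [Fin.sum_univ_two] at this
    rw [divergence_advection hps hqs hev]
    simp only [Fin.sum_univ_two]
    change _ = (fderiv ℝ p x (1, 0) * fderiv ℝ p x (1, 0) +
      fderiv ℝ p x (0, 1) * fderiv ℝ q x (1, 0)) + (fderiv ℝ q x (1, 0) * fderiv ℝ p x (0, 1) +
      fderiv ℝ q x (0, 1) * fderiv ℝ q x (0, 1))
    ring
  -- Points of the channel over `a` and `b` lie outside the open truncation, where `u` is required
  -- to vanish.
  have hend : ∀ t, (t = a ∨ t = b) → ∫ y in f₁ t..f₂ t, F (t, y) = 0 := by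
    intro t ht
    rw [intervalIntegral.integral_of_le (hlt t).le, integral_Ioc_eq_integral_Ioo]
    refine setIntegral_eq_zero_of_forall_eq_zero fun y hy => ?_
    have hzero := hu.vanish (t, y) ⟨hy, fun h => by
      rcases ht with rfl | rfl
      · exact lt_irrefl _ h.2.1
      · exact lt_irrefl _ h.2.2⟩
    simp [hF, hp, hq, hzero]
  have hwall : ∀ f : ℝ → ℝ, ContDiff ℝ ∞ f →
      (∀ t ∈ Icc a b, u (t, f t) 1 = deriv f t * u (t, f t) 0) →
      ∫ t in a..b, (H (t, f t) - deriv f t * F (t, f t)) =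
        ∫ t in a..b, u (t, f t) 0 ^ 2 * deriv (deriv f) t := by
    intro f hf htan
    rw [intervalIntegral.integral_of_le hab.le, intervalIntegral.integral_of_le hab.le,
      integral_Ioc_eq_integral_Ioo, integral_Ioc_eq_integral_Ioo]
    -- The open interval is essential: `advection_flux` needs tangency in a neighbourhood of `t`,
    -- and tangency is known over `[a, b]` only.
    refine setIntegral_congr_fun measurableSet_Ioo fun t ht => ?_
    refine advection_flux hps hqs hf ?_
    filter_upwards [Ioo_mem_nhds ht.1 ht.2] with s hs
    exact htan s ⟨hs.1.le, hs.2.le⟩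
  rw [← setIntegral_congr_fun (measurableSet_truncated hf₁.continuous hf₂.continuous a b) hdiv,
    setIntegral_truncated hf₁.continuous hf₂.continuous hlt hab
      (((contDiff_fderiv_apply hFs _).add (contDiff_fderiv_apply hHs _)).continuous),
    integral_divergence_between_graphs hFs hHs hf₁ hf₂, hend a (Or.inl rfl), hend b (Or.inr rfl),
    hwall f₁ hf₁ fun t ht => (inner_lowerNormal_eq_zero_iff f₁ t _).1 (hu.lower t ht),
    hwall f₂ hf₂ fun t ht => (inner_upperNormal_eq_zero_iff f₂ t _).1 (hu.upper t ht)]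
  ring

/-- Integrates the pointwise curvature bound after replacing `|∂_τ n|` by its essential supremum.
The supremum may be infinite, hence the formulation in `ℝ≥0∞`. -/
theorem ofReal_integral_curvature_le {f : ℝ → ℝ} (hf : ContDiff ℝ ∞ f) {a b : ℝ} (hab : a < b)
    {u : ℝ × ℝ → Vec} (hu : Continuous u)
    (htan : ∀ t ∈ Icc a b, u (t, f t) 1 = deriv f t * u (t, f t) 0) :
    ENNReal.ofReal (∫ t in a..b, u (t, f t) 0 ^ 2 * |deriv (deriv f) t|) ≤
      eLpNorm (tangentialDeriv f (lowerNormal f)) ∞ volume *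
        ∫⁻ x, ‖u x‖ₑ ^ 2 ∂graphMeasure f a b := by
  have hf' := hf.continuous
  have hd : Continuous (deriv (deriv f)) := by
    have : ContDiff ℝ ∞ (deriv (deriv f)) := by simpa using hf.iterate_deriv 2
    exact this.continuous
  have hρ := (continuous_arclengthDensity hf).measurable
  have hmeas : Measurable fun x => ‖u x‖ₑ ^ 2 := (by fun_prop : Continuous _).measurable
  rw [intervalIntegral.integral_of_le hab.le, integral_Ioc_eq_integral_Ioo,
    ofReal_integral_eq_lintegral_ofReal, lintegral_graphMeasure hf a b hmeas,
    ← lintegral_const_mul]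
  · refine lintegral_mono_ae ?_
    have hae := ae_restrict_of_ae (s := Ioo a b)
      (ae_le_eLpNormEssSup (f := tangentialDeriv f (lowerNormal f)) (μ := volume))
    filter_upwards [hae, ae_restrict_mem measurableSet_Ioo] with t ht htm
    refine (ENNReal.ofReal_le_ofReal
      (sq_mul_abs_deriv_deriv_le hf t _ (htan t ⟨htm.1.le, htm.2.le⟩))).trans ?_
    rw [ENNReal.ofReal_mul (norm_nonneg _), ENNReal.ofReal_mul (arclengthDensity_pos f t).le,
      ← enorm_sq_eq_ofReal_norm_sq, ofReal_norm, eLpNorm_exponent_top]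
    gcongr
  · have : Measurable fun t => ‖u (t, f t)‖ₑ ^ 2 := (by fun_prop : Continuous _).measurable
    fun_prop
  · have hc : Continuous fun t => u (t, f t) 0 ^ 2 * |deriv (deriv f) t| := by fun_prop
    exact (hc.continuousOn.integrableOn_compact isCompact_Icc).mono_set Ioo_subset_Icc_self
  · exact Eventually.of_forall fun t => by positivity

/-- The Korn-type inequality for smooth fields. -/
theorem IsCSigma.matL2Sq_grad_le {f₁ f₂ : ℝ → ℝ} (hf₁ : ContDiff ℝ ∞ f₁)
    (hf₂ : ContDiff ℝ ∞ f₂) (hlt : ∀ t, f₁ t < f₂ t) {a b : ℝ} (hab : a < b)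
    {u : ℝ × ℝ → Vec} (hu : IsCSigma f₁ f₂ a b u) :
    matL2Sq (truncated f₁ f₂ a b) (grad u) ≤
      2 * matL2Sq (truncated f₁ f₂ a b) (fun x => strain (grad u x)) +
        normalVariation f₁ f₂ * vecL2Sq (wallMeasure f₁ f₂ a b) u := by
  have hg := continuous_grad_apply hu.smooth
  have hs : ∀ i j, Continuous fun x => strain (grad u x) i j := by
    intro i j
    have h₁ := hg i j
    have h₂ := hg j i
    simp only [strain, Matrix.of_apply]
    fun_prop
  have hu' := hu.smooth.continuous
  have hcont : ∀ f : ℝ → ℝ, ContDiff ℝ ∞ f →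
      Continuous fun t => u (t, f t) 0 ^ 2 * deriv (deriv f) t := by
    intro f hf
    have hf' := hf.continuous
    have : ContDiff ℝ ∞ (deriv (deriv f)) := by simpa using hf.iterate_deriv 2
    have := this.continuous
    fun_prop
  have habs : ∀ f : ℝ → ℝ, ContDiff ℝ ∞ f →
      |∫ t in a..b, u (t, f t) 0 ^ 2 * deriv (deriv f) t| ≤
        ∫ t in a..b, u (t, f t) 0 ^ 2 * |deriv (deriv f) t| := by
    intro f hf
    refine (intervalIntegral.abs_integral_le_integral_abs hab.le).trans (le_of_eq ?_)
    refine intervalIntegral.integral_congr fun t _ => ?_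
    simp only [abs_mul, abs_pow, sq_abs]
  set D := truncated f₁ f₂ a b with hD
  have hint : ∀ g : ℝ × ℝ → ℝ, Continuous g → IntegrableOn g D := fun g =>
    integrableOn_truncated hf₁.continuous hf₂.continuous a b
  -- This is `|A|² = 2|D|² - ∑ A_ij A_ji`, integrated.
  have hsplit : ∫ x in D, ∑ i, ∑ j, grad u x i j ^ 2 =
      2 * (∫ x in D, ∑ i, ∑ j, strain (grad u x) i j ^ 2) -
        ∫ x in D, ∑ i, ∑ j, grad u x i j * grad u x j i := by
    rw [← integral_const_mul, ← integral_sub]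
    · refine integral_congr_ae (Eventually.of_forall fun x => ?_)
      simp only [Fin.sum_univ_two, strain, Matrix.of_apply]
      ring
    · exact hint _ (by fun_prop)
    · exact hint _ (by fun_prop)
  have hreal : ∫ x in D, ∑ i, ∑ j, grad u x i j ^ 2 ≤
      2 * (∫ x in D, ∑ i, ∑ j, strain (grad u x) i j ^ 2) +
        ((∫ t in a..b, u (t, f₁ t) 0 ^ 2 * |deriv (deriv f₁) t|) +
          ∫ t in a..b, u (t, f₂ t) 0 ^ 2 * |deriv (deriv f₂) t|) := by
    rw [hsplit, integral_cross_terms hf₁ hf₂ hlt hab hu]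
    have h₁ := abs_le.1 (habs f₁ hf₁)
    have h₂ := abs_le.1 (habs f₂ hf₂)
    linarith [h₁.2, h₂.1]
  rw [matL2Sq_eq_ofReal hf₁.continuous hf₂.continuous a b hg,
    matL2Sq_eq_ofReal hf₁.continuous hf₂.continuous a b hs]
  refine (ENNReal.ofReal_le_ofReal hreal).trans (ENNReal.ofReal_add_le.trans ?_)
  rw [ENNReal.ofReal_mul zero_le_two, ENNReal.ofReal_ofNat]
  gcongr
  refine ENNReal.ofReal_add_le.trans ?_
  rw [vecL2Sq, wallMeasure, lintegral_add_measure, mul_add]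
  have hup : eLpNorm (tangentialDeriv f₂ (upperNormal f₂)) ∞ volume =
      eLpNorm (tangentialDeriv f₂ (lowerNormal f₂)) ∞ volume :=
    eLpNorm_congr_norm_ae (Eventually.of_forall (norm_tangentialDeriv_upperNormal f₂))
  refine add_le_add ?_ ?_
  · refine (ofReal_integral_curvature_le hf₁ hab hu' fun t ht =>
      (inner_lowerNormal_eq_zero_iff f₁ t _).1 (hu.lower t ht)).trans ?_
    gcongr
    exact le_max_left _ _
  · refine (ofReal_integral_curvature_le hf₂ hab hu' fun t ht =>
      (inner_upperNormal_eq_zero_iff f₂ t _).1 (hu.upper t ht)).trans ?_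
    gcongr
    rw [← hup]
    exact le_max_right _ _

theorem kornConst_le_one (α : ℝ) (f₁ f₂ : ℝ → ℝ) : kornConst α f₁ f₂ ≤ 1 :=
  ENNReal.div_le_of_le_mul (by rw [one_mul]; exact le_self_add)

/-- Enlarge `‖∂_τ n‖_∞` to the denominator of `𝔠` and cancel. The inequality `(x / y) * y ≤ x` holds
throughout `ℝ≥0∞`, so the degenerate denominators `0` and `∞` need no separate treatment. -/
theorem kornConst_mul_normalVariation_le (α : ℝ) (f₁ f₂ : ℝ → ℝ) :
    kornConst α f₁ f₂ * normalVariation f₁ f₂ ≤ ENNReal.ofReal α :=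
  (mul_le_mul_right le_add_self _).trans (ENNReal.mul_le_of_le_div le_rfl)

/-- The possibly infinite coefficient `‖∂_τ n‖_∞` is absorbed into `α` before any limit is taken, so
that every coefficient is finite and each product is continuous. -/
theorem IsCSigma.kornConst_mul_le {f₁ f₂ : ℝ → ℝ} (hf₁ : ContDiff ℝ ∞ f₁)
    (hf₂ : ContDiff ℝ ∞ f₂) (hlt : ∀ t, f₁ t < f₂ t) (α : ℝ) {a b : ℝ} (hab : a < b)
    {u : ℝ × ℝ → Vec} (hu : IsCSigma f₁ f₂ a b u) :
    kornConst α f₁ f₂ * matL2Sq (truncated f₁ f₂ a b) (grad u) ≤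
      2 * matL2Sq (truncated f₁ f₂ a b) (fun x => strain (grad u x)) +
        ENNReal.ofReal α * vecL2Sq (wallMeasure f₁ f₂ a b) u := by
  calc _ ≤ kornConst α f₁ f₂ * (2 * matL2Sq (truncated f₁ f₂ a b) (fun x => strain (grad u x)) +
        normalVariation f₁ f₂ * vecL2Sq (wallMeasure f₁ f₂ a b) u) := by
        gcongr
        exact hu.matL2Sq_grad_le hf₁ hf₂ hlt hab
    _ = kornConst α f₁ f₂ * (2 * matL2Sq (truncated f₁ f₂ a b) (fun x => strain (grad u x))) +
        kornConst α f₁ f₂ * normalVariation f₁ f₂ * vecL2Sq (wallMeasure f₁ f₂ a b) u := by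
        rw [mul_add, mul_assoc]
    _ ≤ _ := by
        refine add_le_add (mul_le_of_le_one_left zero_le (kornConst_le_one α f₁ f₂)) ?_
        gcongr
        exact kornConst_mul_normalVariation_le α f₁ f₂

/-! ### Trace inequality -/

/-- Integrate the derivative of `(y - c) w²` over `[l, r]`. Taking `c` to be one endpoint isolates
the value of `w` at the other. -/
theorem weighted_sq_sub_le {w w' : ℝ → ℝ} (hw : ∀ y, HasDerivAt w (w' y) y)
    (hw' : Continuous w') {l r : ℝ} (hlr : l ≤ r) {c : ℝ} (hc : c ∈ Icc l r) :
    (r - c) * w r ^ 2 - (l - c) * w l ^ 2 ≤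
      ∫ y in l..r, (2 * w y ^ 2 + (r - l) ^ 2 * w' y ^ 2) := by
  have hwc : Continuous w := continuous_iff_continuousAt.2 fun y => (hw y).continuousAt
  have hderiv : ∀ y ∈ uIcc l r, HasDerivAt (fun y => (y - c) * w y ^ 2)
      (w y ^ 2 + 2 * (y - c) * w y * w' y) y := by
    intro y _
    have := ((hasDerivAt_id y).sub_const c).mul ((hw y).pow 2)
    refine this.congr_deriv ?_
    simp
    ring
  rw [← intervalIntegral.integral_eq_sub_of_hasDerivAt hderiv
    ((by fun_prop : Continuous _).intervalIntegrable _ _)]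
  refine intervalIntegral.integral_mono_on hlr ((by fun_prop : Continuous _).intervalIntegrable _ _)
    ((by fun_prop : Continuous _).intervalIntegrable _ _) fun y hy => ?_
  have h₁ : (y - c) ^ 2 ≤ (r - l) ^ 2 :=
    sq_le_sq' (by linarith [hy.1, hc.2]) (by linarith [hy.2, hc.1])
  -- Young's inequality `2(y - c) w w' ≤ w² + (y - c)² w'²`, with `|y - c| ≤ r - l`.
  nlinarith [sq_nonneg (w y - (y - c) * w' y), mul_le_mul_of_nonneg_right h₁ (sq_nonneg (w' y))]

theorem endpoint_sq_le {w w' : ℝ → ℝ} (hw : ∀ y, HasDerivAt w (w' y) y)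
    (hw' : Continuous w') {l r e : ℝ} (hlr : l < r) (he : e = l ∨ e = r) :
    w e ^ 2 ≤ (2 / (r - l) + (r - l)) * ∫ y in l..r, (w y ^ 2 + w' y ^ 2) := by
  have hwc : Continuous w := continuous_iff_continuousAt.2 fun y => (hw y).continuousAt
  have hpos : 0 < r - l := sub_pos.2 hlr
  have h : (r - l) * w e ^ 2 ≤ ∫ y in l..r, (2 * w y ^ 2 + (r - l) ^ 2 * w' y ^ 2) := by
    rcases he with rfl | rfl
    · have := weighted_sq_sub_le hw hw' hlr.le (right_mem_Icc.2 hlr.le)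
      linarith
    · have := weighted_sq_sub_le hw hw' hlr.le (left_mem_Icc.2 hlr.le)
      linarith
  have hmono : ∫ y in l..r, (2 * w y ^ 2 + (r - l) ^ 2 * w' y ^ 2) ≤
      ∫ y in l..r, (2 + (r - l) ^ 2) * (w y ^ 2 + w' y ^ 2) := by
    refine intervalIntegral.integral_mono_on hlr.le
      ((by fun_prop : Continuous _).intervalIntegrable _ _)
      ((by fun_prop : Continuous _).intervalIntegrable _ _) fun y _ => ?_
    have : 0 ≤ (r - l) ^ 2 * w y ^ 2 := by positivity
    nlinarith [sq_nonneg (w' y)]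
  rw [intervalIntegral.integral_const_mul] at hmono
  have h' := h.trans hmono
  rw [mul_comm, ← le_div_iff₀ hpos] at h'
  refine h'.trans (le_of_eq ?_)
  field_simp

/-- The trace inequality on one wall. -/
theorem exists_lintegral_graphMeasure_le {f₁ f₂ : ℝ → ℝ} (hf₁ : ContDiff ℝ ∞ f₁)
    (hf₂ : ContDiff ℝ ∞ f₂) (hlt : ∀ t, f₁ t < f₂ t) (a b : ℝ) {f : ℝ → ℝ}
    (hf : f = f₁ ∨ f = f₂) :
    ∃ C : ℝ≥0∞, C ≠ ⊤ ∧ ∀ u : ℝ × ℝ → Vec, ContDiff ℝ ∞ u →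
      vecL2Sq (graphMeasure f a b) u ≤
        C * (vecL2Sq (volume.restrict (truncated f₁ f₂ a b)) u +
          matL2Sq (truncated f₁ f₂ a b) (grad u)) := by
  have hfs : ContDiff ℝ ∞ f := by rcases hf with rfl | rfl <;> assumption
  have c₁ := hf₁.continuous
  have c₂ := hf₂.continuous
  have cf := hfs.continuous
  have cρ := continuous_arclengthDensity hfs
  have hne : ∀ t, f₂ t - f₁ t ≠ 0 := fun t => (sub_pos.2 (hlt t)).ne'
  -- The one-dimensional endpoint constant for the vertical segment over `t`, times the arclength
  -- density. The width is continuous and positive, so this is bounded on `[a, b]`, and the bound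
  -- `M` is the trace constant.
  have hcont : Continuous fun t =>
      arclengthDensity f t * (2 / (f₂ t - f₁ t) + (f₂ t - f₁ t)) := by
    fun_prop (disch := assumption)
  obtain ⟨M, hM⟩ := (isCompact_Icc.image_of_continuousOn
    (hcont.continuousOn (s := Icc a b))).bddAbove
  refine ⟨ENNReal.ofReal M, ENNReal.ofReal_ne_top, fun u hu => ?_⟩
  have cu := hu.continuous
  have cg := continuous_grad_apply hu
  have hmeas : Measurable fun x => ‖u x‖ₑ ^ 2 := (by fun_prop : Continuous _).measurable
  set E : ℝ × ℝ → ℝ := fun x => ‖u x‖ ^ 2 + ∑ i, ∑ j, grad u x i j ^ 2 with hE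
  have hEc : Continuous E := by fun_prop
  have hE0 : ∀ x, 0 ≤ E x := fun x => add_nonneg (sq_nonneg _)
    (Finset.sum_nonneg fun i _ => Finset.sum_nonneg fun j _ => sq_nonneg _)
  have hsum : vecL2Sq (volume.restrict (truncated f₁ f₂ a b)) u +
      matL2Sq (truncated f₁ f₂ a b) (grad u) =
      ∫⁻ x in truncated f₁ f₂ a b, ENNReal.ofReal (E x) := by
    rw [vecL2Sq, matL2Sq, ← lintegral_add_left hmeas]
    refine lintegral_congr fun x => ?_
    rw [enorm_sq_eq_ofReal_norm_sq, sum_enorm_sq_eq_ofReal, ← ENNReal.ofReal_add (sq_nonneg _)]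
    exact Finset.sum_nonneg fun i _ => Finset.sum_nonneg fun j _ => sq_nonneg _
  rw [hsum, vecL2Sq, lintegral_graphMeasure hfs a b hmeas,
    setLIntegral_truncated c₁ c₂ a b hEc.measurable.ennreal_ofReal,
    ← lintegral_const_mul' _ _ ENNReal.ofReal_ne_top]
  refine setLIntegral_mono' measurableSet_Ioo fun t ht => ?_
  have htI : t ∈ Icc a b := ⟨ht.1.le, ht.2.le⟩
  have hEt : Continuous fun y => E (t, y) := by fun_prop
  have hcomp : ∀ i : Fin 2, u (t, f t) i ^ 2 ≤ (2 / (f₂ t - f₁ t) + (f₂ t - f₁ t)) *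
      ∫ y in f₁ t..f₂ t, (u (t, y) i ^ 2 + grad u (t, y) i 1 ^ 2) := by
    intro i
    have cgi := cg i 1
    refine endpoint_sq_le (w := fun y => u (t, y) i) (w' := fun y => grad u (t, y) i 1)
      (fun y => ?_) (by fun_prop) (hlt t) (by rcases hf with rfl | rfl <;> simp)
    have hline : HasDerivAt (fun y : ℝ => (t, y)) ((0 : ℝ), (1 : ℝ)) y :=
      (hasDerivAt_const y t).prodMk (hasDerivAt_id y)
    exact ((contDiff_component hu i).differentiable (by simp) (t, y)).hasFDerivAt.comp_hasDerivAt
      y hline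
  have hnorm : ‖u (t, f t)‖ ^ 2 ≤ (2 / (f₂ t - f₁ t) + (f₂ t - f₁ t)) *
      ∫ y in f₁ t..f₂ t, E (t, y) := by
    have hpos := sub_pos.2 (hlt t)
    rw [EuclideanSpace.real_norm_sq_eq, Fin.sum_univ_two]
    refine (add_le_add (hcomp 0) (hcomp 1)).trans ?_
    have g₀ := cg 0 1
    have g₁ := cg 1 1
    rw [← mul_add, ← intervalIntegral.integral_add
      ((by fun_prop : Continuous _).intervalIntegrable _ _)
      ((by fun_prop : Continuous _).intervalIntegrable _ _)]
    refine mul_le_mul_of_nonneg_left ?_ (by positivity)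
    refine intervalIntegral.integral_mono_on (hlt t).le
      ((by fun_prop : Continuous _).intervalIntegrable _ _) (hEt.intervalIntegrable _ _)
      fun y _ => ?_
    simp only [hE, EuclideanSpace.real_norm_sq_eq, Fin.sum_univ_two]
    nlinarith [sq_nonneg (grad u (t, y) 0 0), sq_nonneg (grad u (t, y) 1 0)]
  have hint0 : 0 ≤ ∫ y in f₁ t..f₂ t, E (t, y) :=
    intervalIntegral.integral_nonneg (hlt t).le fun y _ => hE0 _
  have hreal : arclengthDensity f t * ‖u (t, f t)‖ ^ 2 ≤ M * ∫ y in f₁ t..f₂ t, E (t, y) := by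
    refine (mul_le_mul_of_nonneg_left hnorm (arclengthDensity_pos f t).le).trans ?_
    rw [← mul_assoc]
    exact mul_le_mul_of_nonneg_right (hM (mem_image_of_mem _ htI)) hint0
  have hM0 : 0 ≤ M := by
    refine le_trans ?_ (hM (mem_image_of_mem _ htI))
    have := arclengthDensity_pos f t
    have := sub_pos.2 (hlt t)
    positivity
  rw [enorm_sq_eq_ofReal_norm_sq, ← ENNReal.ofReal_mul (arclengthDensity_pos f t).le]
  refine (ENNReal.ofReal_le_ofReal hreal).trans (le_of_eq ?_)
  rw [ENNReal.ofReal_mul hM0, intervalIntegral.integral_of_le (hlt t).le,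
    integral_Ioc_eq_integral_Ioo, ofReal_integral_eq_lintegral_ofReal]
  · exact (hEt.continuousOn.integrableOn_compact isCompact_Icc).mono_set Ioo_subset_Icc_self
  · exact Eventually.of_forall fun y => hE0 _

/-- The trace inequality on the walls of the truncated channel. -/
theorem exists_vecL2Sq_wallMeasure_le {f₁ f₂ : ℝ → ℝ} (hf₁ : ContDiff ℝ ∞ f₁)
    (hf₂ : ContDiff ℝ ∞ f₂) (hlt : ∀ t, f₁ t < f₂ t) (a b : ℝ) :
    ∃ C : ℝ≥0∞, C ≠ ⊤ ∧ ∀ u : ℝ × ℝ → Vec, ContDiff ℝ ∞ u →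
      vecL2Sq (wallMeasure f₁ f₂ a b) u ≤
        C * (vecL2Sq (volume.restrict (truncated f₁ f₂ a b)) u +
          matL2Sq (truncated f₁ f₂ a b) (grad u)) := by
  obtain ⟨C₁, h₁, H₁⟩ := exists_lintegral_graphMeasure_le hf₁ hf₂ hlt a b (Or.inl rfl)
  obtain ⟨C₂, h₂, H₂⟩ := exists_lintegral_graphMeasure_le hf₁ hf₂ hlt a b (Or.inr rfl)
  refine ⟨C₁ + C₂, ENNReal.add_ne_top.2 ⟨h₁, h₂⟩, fun u hu => ?_⟩
  rw [vecL2Sq, wallMeasure, lintegral_add_measure, add_mul]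
  exact add_le_add (H₁ u hu) (H₂ u hu)

/-! ### Convergence of `L²` norms -/

section LimitsL2

variable {X E : Type*} [MeasurableSpace X] {μ : Measure X} [NormedAddCommGroup E]

theorem lintegral_enorm_sq_eq_eLpNorm_sq (f : X → E) :
    ∫⁻ x, ‖f x‖ₑ ^ 2 ∂μ = eLpNorm f 2 μ ^ 2 := by
  have h := eLpNorm_nnreal_pow_eq_lintegral (f := f) (μ := μ) (p := 2) two_ne_zero
  have h' : eLpNorm f 2 μ ^ (2 : ℝ) = ∫⁻ x, ‖f x‖ₑ ^ (2 : ℝ) ∂μ := by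
    simpa using h
  simpa only [ENNReal.rpow_two] using h'.symm

theorem tendsto_eLpNorm_zero_iff {ι : Type*} {l : Filter ι} {f : ι → X → E} :
    Tendsto (fun n => eLpNorm (f n) 2 μ) l (𝓝 0) ↔
      Tendsto (fun n => ∫⁻ x, ‖f n x‖ₑ ^ 2 ∂μ) l (𝓝 0) := by
  simp only [lintegral_enorm_sq_eq_eLpNorm_sq]
  constructor <;> intro h
  · simpa using ENNReal.Tendsto.pow (n := 2) h
  · have := h.ennrpow_const (1 / 2)
    have e : ∀ n, (eLpNorm (f n) 2 μ ^ 2) ^ (1 / 2 : ℝ) = eLpNorm (f n) 2 μ := by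
      intro n
      rw [← ENNReal.rpow_natCast, ← ENNReal.rpow_mul]
      norm_num
    simp only [e] at this
    simpa using this

/-- The norm of `f n` lies between `‖g‖ - ‖f n - g‖` and `‖f n - g‖ + ‖g‖`; finiteness of `‖g‖`
makes the truncated subtraction continuous at the limit. -/
theorem tendsto_lintegral_enorm_sq {f : ℕ → X → E} {g : X → E}
    (hf : ∀ n, AEStronglyMeasurable (f n) μ) (hg : MemLp g 2 μ)
    (h : Tendsto (fun n => ∫⁻ x, ‖f n x - g x‖ₑ ^ 2 ∂μ) atTop (𝓝 0)) :
    Tendsto (fun n => ∫⁻ x, ‖f n x‖ₑ ^ 2 ∂μ) atTop (𝓝 (∫⁻ x, ‖g x‖ₑ ^ 2 ∂μ)) := by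
  have h' : Tendsto (fun n => eLpNorm (f n - g) 2 μ) atTop (𝓝 0) :=
    tendsto_eLpNorm_zero_iff.2 h
  simp only [lintegral_enorm_sq_eq_eLpNorm_sq]
  refine ENNReal.Tendsto.pow ?_
  have hlow : Tendsto (fun n => eLpNorm g 2 μ - eLpNorm (f n - g) 2 μ) atTop
      (𝓝 (eLpNorm g 2 μ)) := by
    simpa using ENNReal.Tendsto.sub (tendsto_const_nhds (x := eLpNorm g 2 μ)) h'
      (Or.inl hg.eLpNorm_ne_top)
  have hup : Tendsto (fun n => eLpNorm (f n - g) 2 μ + eLpNorm g 2 μ) atTop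
      (𝓝 (eLpNorm g 2 μ)) := by
    simpa using h'.add (tendsto_const_nhds (x := eLpNorm g 2 μ))
  refine tendsto_of_tendsto_of_tendsto_of_le_of_le hlow hup (fun n => ?_) fun n => ?_
  · refine tsub_le_iff_right.2 ?_
    have := eLpNorm_sub_le (hf n) ((hf n).sub hg.1) (p := 2) one_le_two
    simpa using this
  · have := eLpNorm_add_le ((hf n).sub hg.1) hg.1 (p := 2) one_le_two
    simpa using this

theorem enorm_sub_sq_le (a b c : E) :
    ‖a - b‖ₑ ^ 2 ≤ 2 * (‖a - c‖ₑ ^ 2 + ‖b - c‖ₑ ^ 2) := by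
  have h : ‖a - b‖ ^ 2 ≤ 2 * (‖a - c‖ ^ 2 + ‖b - c‖ ^ 2) := by
    have h₁ : ‖a - b‖ ≤ ‖a - c‖ + ‖b - c‖ := by
      simpa using norm_sub_le (a - c) (b - c)
    nlinarith [sq_nonneg (‖a - c‖ - ‖b - c‖), norm_nonneg (a - b)]
  have := ENNReal.ofReal_le_ofReal h
  rwa [ENNReal.ofReal_mul zero_le_two, ENNReal.ofReal_add (by positivity) (by positivity),
    ENNReal.ofReal_pow (norm_nonneg _), ENNReal.ofReal_pow (norm_nonneg _),
    ENNReal.ofReal_pow (norm_nonneg _), ofReal_norm, ofReal_norm, ofReal_norm,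
    ENNReal.ofReal_ofNat] at this

end LimitsL2

/-! ### Quasi-triangle inequalities and limits for fields and matrix fields -/

theorem vecL2Sq_sub_le {μ : Measure (ℝ × ℝ)} {u w v : ℝ × ℝ → Vec}
    (hu : AEStronglyMeasurable u μ) (hv : AEStronglyMeasurable v μ) :
    vecL2Sq μ (fun x => u x - w x) ≤
      2 * (vecL2Sq μ (fun x => u x - v x) + vecL2Sq μ (fun x => w x - v x)) := by
  have hm : AEMeasurable (fun x => ‖u x - v x‖ₑ ^ 2) μ := (hu.sub hv).enorm.pow_const 2
  rw [vecL2Sq, vecL2Sq, vecL2Sq, ← lintegral_add_left' hm,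
    ← lintegral_const_mul' _ _ ENNReal.ofNat_ne_top]
  exact lintegral_mono fun x => enorm_sub_sq_le _ _ _

theorem aemeasurable_sum_enorm_sq {μ : Measure (ℝ × ℝ)} {A : ℝ × ℝ → Matrix (Fin 2) (Fin 2) ℝ}
    (hA : ∀ i j, AEStronglyMeasurable (fun x => A x i j) μ) :
    AEMeasurable (fun x => ∑ i, ∑ j, ‖A x i j‖ₑ ^ 2) μ :=
  Finset.aemeasurable_fun_sum _ fun i _ => Finset.aemeasurable_fun_sum _ fun j _ =>
    (hA i j).enorm.pow_const 2

theorem matL2Sq_sub_le {D : Set (ℝ × ℝ)} {A B G : ℝ × ℝ → Matrix (Fin 2) (Fin 2) ℝ}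
    (hA : ∀ i j, AEStronglyMeasurable (fun x => A x i j) (volume.restrict D))
    (hG : ∀ i j, AEStronglyMeasurable (fun x => G x i j) (volume.restrict D)) :
    matL2Sq D (fun x => A x - B x) ≤
      2 * (matL2Sq D (fun x => A x - G x) + matL2Sq D (fun x => B x - G x)) := by
  have hm : AEMeasurable (fun x => ∑ i, ∑ j, ‖(A x - G x) i j‖ₑ ^ 2) (volume.restrict D) :=
    aemeasurable_sum_enorm_sq fun i j => (hA i j).sub (hG i j)
  rw [matL2Sq, matL2Sq, matL2Sq, ← lintegral_add_left' hm, ← lintegral_const_mul' _ _ ENNReal.ofNat_ne_top]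
  refine lintegral_mono fun x => ?_
  simp only [← Finset.sum_add_distrib, Finset.mul_sum]
  exact Finset.sum_le_sum fun i _ => Finset.sum_le_sum fun j _ => enorm_sub_sq_le _ _ _

theorem matL2Sq_eq_sum {D : Set (ℝ × ℝ)} {A : ℝ × ℝ → Matrix (Fin 2) (Fin 2) ℝ}
    (hA : ∀ i j, AEStronglyMeasurable (fun x => A x i j) (volume.restrict D)) :
    matL2Sq D A = ∑ i, ∑ j, ∫⁻ x in D, ‖A x i j‖ₑ ^ 2 := by
  rw [matL2Sq, lintegral_finsetSum' _ fun i _ => Finset.aemeasurable_fun_sum _ fun j _ =>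
    (hA i j).enorm.pow_const 2]
  exact Finset.sum_congr rfl fun i _ => lintegral_finsetSum' _ fun j _ =>
    (hA i j).enorm.pow_const 2

theorem tendsto_matL2Sq {D : Set (ℝ × ℝ)} {A : ℕ → ℝ × ℝ → Matrix (Fin 2) (Fin 2) ℝ}
    {G : ℝ × ℝ → Matrix (Fin 2) (Fin 2) ℝ}
    (hA : ∀ n i j, AEStronglyMeasurable (fun x => A n x i j) (volume.restrict D))
    (hG : ∀ i j, MemLp (fun x => G x i j) 2 (volume.restrict D))
    (h : Tendsto (fun n => matL2Sq D fun x => A n x - G x) atTop (𝓝 0)) :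
    Tendsto (fun n => matL2Sq D (A n)) atTop (𝓝 (matL2Sq D G)) := by
  simp only [matL2Sq_eq_sum (hA _), matL2Sq_eq_sum fun i j => (hG i j).1]
  refine tendsto_finsetSum _ fun i _ => tendsto_finsetSum _ fun j _ => ?_
  refine tendsto_lintegral_enorm_sq (fun n => hA n i j) (hG i j) ?_
  refine tendsto_of_tendsto_of_tendsto_of_le_of_le tendsto_const_nhds h (fun n => zero_le)
    fun n => lintegral_mono fun x => ?_
  exact (Finset.single_le_sum (f := fun j => ‖(A n x - G x) i j‖ₑ ^ 2) (fun _ _ => zero_le)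
    (Finset.mem_univ j)).trans
    (Finset.single_le_sum (f := fun i => ∑ j, ‖(A n x - G x) i j‖ₑ ^ 2) (fun _ _ => zero_le)
    (Finset.mem_univ i))

/-- Symmetrization is linear and does not increase the Frobenius norm: the defect is half the square
of the difference of the off-diagonal entries. -/
theorem matL2Sq_strain_sub_le (D : Set (ℝ × ℝ)) (A G : ℝ × ℝ → Matrix (Fin 2) (Fin 2) ℝ) :
    matL2Sq D (fun x => strain (A x) - strain (G x)) ≤ matL2Sq D (fun x => A x - G x) := by
  refine lintegral_mono fun x => ?_
  rw [sum_enorm_sq_eq_ofReal, sum_enorm_sq_eq_ofReal]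
  refine ENNReal.ofReal_le_ofReal ?_
  simp only [Fin.sum_univ_two, strain, Matrix.of_apply, Matrix.sub_apply]
  nlinarith [sq_nonneg ((A x 0 1 - G x 0 1) - (A x 1 0 - G x 1 0))]

theorem matL2Sq_congr_ae {D : Set (ℝ × ℝ)} {A B : ℝ × ℝ → Matrix (Fin 2) (Fin 2) ℝ}
    (h : A =ᵐ[volume.restrict D] B) : matL2Sq D A = matL2Sq D B :=
  lintegral_congr_ae (h.mono fun x hx => by simp only [hx])

/-! ### Uniqueness of weak gradients, existence and uniqueness of the wall trace -/

/-- Weak gradients on a bounded open set are unique. -/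
theorem HasH1Grad.ae_eq {D : Set (ℝ × ℝ)} (hD : IsOpen D) (hfin : volume D ≠ ⊤)
    {v : ℝ × ℝ → Vec} {G G' : ℝ × ℝ → Matrix (Fin 2) (Fin 2) ℝ}
    (h : HasH1Grad D v G) (h' : HasH1Grad D v G') : G =ᵐ[volume.restrict D] G' := by
  have : IsFiniteMeasure (volume.restrict D) := ⟨by simpa using hfin.lt_top⟩
  have hij : ∀ i j, ∀ᵐ x ∂volume.restrict D, G x i j - G' x i j = 0 := by
    intro i j
    have hi := (h.memLp_grad i j).integrable one_le_two
    have hi' := (h'.memLp_grad i j).integrable one_le_two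
    rw [ae_restrict_iff' hD.measurableSet]
    -- The fundamental lemma of the calculus of variations, applied to `G i j - G' i j`; finite
    -- measure has turned `L²` into the integrability it needs.
    refine hD.ae_eq_zero_of_integral_contDiff_smul_eq_zero
      (IntegrableOn.locallyIntegrableOn (hi.sub hi')) fun φ hφ hc hsub => ?_
    obtain ⟨M, hM⟩ := hc.exists_bound_of_continuous hφ.continuous
    have hb : ∀ {f : ℝ × ℝ → ℝ}, Integrable f (volume.restrict D) →
        Integrable (fun x => f x * φ x) (volume.restrict D) := fun hf =>
      hf.mul_bdd hφ.continuous.aestronglyMeasurable (Eventually.of_forall hM)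
    rw [← setIntegral_eq_integral_of_forall_compl_eq_zero (s := D) fun x hx => by
      rw [image_eq_zero_of_notMem_tsupport fun hx' => hx (hsub hx'), zero_smul]]
    have heq := (h.weak φ hφ hc hsub i j).symm.trans (h'.weak φ hφ hc hsub i j)
    calc ∫ x in D, φ x • (G x i j - G' x i j)
        = ∫ x in D, (G x i j * φ x - G' x i j * φ x) :=
          integral_congr_ae (Eventually.of_forall fun x => by simp only [smul_eq_mul]; ring)
      _ = 0 := by
          rw [integral_sub (hb hi) (hb hi')]
          linarith
  filter_upwards [hij 0 0, hij 0 1, hij 1 0, hij 1 1] with x h₁ h₂ h₃ h₄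
  ext i j
  fin_cases i <;> fin_cases j <;> simp_all [sub_eq_zero]

theorem grad_sub {u w : ℝ × ℝ → Vec} (hu : ContDiff ℝ ∞ u) (hw : ContDiff ℝ ∞ w) (x : ℝ × ℝ) :
    grad (fun y => u y - w y) x = grad u x - grad w x := by
  ext i j
  have h₁ := (contDiff_component hu i).differentiable (by simp) x
  have h₂ := (contDiff_component hw i).differentiable (by simp) x
  simp only [grad, partialDeriv, Matrix.of_apply, Matrix.sub_apply, PiLp.sub_apply]
  rw [fderiv_fun_sub h₁ h₂, sub_apply]

/-- Smooth fields that are close to the same `H¹` field have close restrictions to the walls. -/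
theorem exists_vecL2Sq_wallMeasure_sub_le {f₁ f₂ : ℝ → ℝ} (hf₁ : ContDiff ℝ ∞ f₁)
    (hf₂ : ContDiff ℝ ∞ f₂) (hlt : ∀ t, f₁ t < f₂ t) (a b : ℝ) :
    ∃ C : ℝ≥0∞, C ≠ ⊤ ∧ ∀ (u w v : ℝ × ℝ → Vec) (G : ℝ × ℝ → Matrix (Fin 2) (Fin 2) ℝ),
      ContDiff ℝ ∞ u → ContDiff ℝ ∞ w → HasH1Grad (truncated f₁ f₂ a b) v G →
      vecL2Sq (wallMeasure f₁ f₂ a b) (fun x => u x - w x) ≤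
        C * ((vecL2Sq (volume.restrict (truncated f₁ f₂ a b)) (fun x => u x - v x) +
          matL2Sq (truncated f₁ f₂ a b) (fun x => grad u x - G x)) +
          (vecL2Sq (volume.restrict (truncated f₁ f₂ a b)) (fun x => w x - v x) +
          matL2Sq (truncated f₁ f₂ a b) (fun x => grad w x - G x))) := by
  obtain ⟨C, hC, H⟩ := exists_vecL2Sq_wallMeasure_le hf₁ hf₂ hlt a b
  refine ⟨C * 2, ENNReal.mul_ne_top hC ENNReal.ofNat_ne_top, fun u w v G hu hw hv => ?_⟩
  refine (H _ (hu.sub hw)).trans ?_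
  rw [mul_assoc]
  gcongr
  have hgrad : grad (fun x => u x - w x) = fun x => grad u x - grad w x :=
    funext fun x => grad_sub hu hw x
  rw [hgrad]
  refine (add_le_add (vecL2Sq_sub_le hu.continuous.aestronglyMeasurable hv.memLp.1)
    (matL2Sq_sub_le (fun i j => (continuous_grad_apply hu i j).aestronglyMeasurable)
      fun i j => (hv.memLp_grad i j).1)).trans (le_of_eq ?_)
  ring

theorem memLp_wallMeasure {f₁ f₂ : ℝ → ℝ} (hf₁ : ContDiff ℝ ∞ f₁)
    (hf₂ : ContDiff ℝ ∞ f₂) (hlt : ∀ t, f₁ t < f₂ t) (a b : ℝ) {u : ℝ × ℝ → Vec}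
    (hu : ContDiff ℝ ∞ u) : MemLp u 2 (wallMeasure f₁ f₂ a b) := by
  refine ⟨hu.continuous.aestronglyMeasurable, ?_⟩
  have cu := hu.continuous
  obtain ⟨C, hC, H⟩ := exists_vecL2Sq_wallMeasure_le hf₁ hf₂ hlt a b
  have h₁ : vecL2Sq (volume.restrict (truncated f₁ f₂ a b)) u ≠ ⊤ := by
    have : Integrable (fun x => ‖u x‖ ^ 2) (volume.restrict (truncated f₁ f₂ a b)) :=
      integrableOn_truncated hf₁.continuous hf₂.continuous a b (by fun_prop)
    have := this.2.ne
    simpa [vecL2Sq, HasFiniteIntegral, enorm_pow] using this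
  have h₂ : matL2Sq (truncated f₁ f₂ a b) (grad u) ≠ ⊤ := by
    rw [matL2Sq_eq_ofReal hf₁.continuous hf₂.continuous a b (continuous_grad_apply hu)]
    exact ENNReal.ofReal_ne_top
  have h := (H u hu).trans_lt (ENNReal.mul_lt_top hC.lt_top (ENNReal.add_ne_top.2 ⟨h₁, h₂⟩).lt_top)
  rw [vecL2Sq, lintegral_enorm_sq_eq_eLpNorm_sq] at h
  exact (ENNReal.pow_lt_top_iff.1 h).resolve_right two_ne_zero

/-- The trace inequality applied to `u n - u m` shows that the wall restrictions are Cauchy in `L²`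
of the walls; the trace is their limit, by completeness. -/
theorem exists_isWallTrace {f₁ f₂ : ℝ → ℝ} (hf₁ : ContDiff ℝ ∞ f₁)
    (hf₂ : ContDiff ℝ ∞ f₂) (hlt : ∀ t, f₁ t < f₂ t) (a b : ℝ) {v : ℝ × ℝ → Vec}
    {G : ℝ × ℝ → Matrix (Fin 2) (Fin 2) ℝ} (hG : HasH1Grad (truncated f₁ f₂ a b) v G)
    {u : ℕ → ℝ × ℝ → Vec} (hu : ∀ n, ContDiff ℝ ∞ (u n))
    (hlim : TendstoH1 (truncated f₁ f₂ a b) u v G) :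
    ∃ g, IsWallTrace f₁ f₂ a b v g := by
  obtain ⟨C, hC, H⟩ := exists_vecL2Sq_wallMeasure_sub_le hf₁ hf₂ hlt a b
  have hmem := fun n => memLp_wallMeasure hf₁ hf₂ hlt a b (hu n)
  have hcauchy : CauchySeq fun n => (hmem n).toLp := by
    rw [Lp.cauchySeq_Lp_iff_cauchySeq_eLpNorm]
    have h : Tendsto (fun n : ℕ × ℕ => eLpNorm (fun x => u n.1 x - u n.2 x) 2
        (wallMeasure f₁ f₂ a b)) atTop (𝓝 0) := by
      refine tendsto_eLpNorm_zero_iff.2 ?_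
      rw [← prod_atTop_atTop_eq]
      have hsum := ENNReal.Tendsto.const_mul (a := C)
        ((hlim.comp (tendsto_fst (f := atTop) (g := atTop))).add
          (hlim.comp (tendsto_snd (f := atTop) (g := atTop)))) (Or.inr hC)
      rw [add_zero, mul_zero] at hsum
      exact tendsto_of_tendsto_of_tendsto_of_le_of_le tendsto_const_nhds hsum
        (fun n => zero_le) fun n => H _ _ v G (hu n.1) (hu n.2) hG
    refine h.congr fun n => eLpNorm_congr_ae ?_
    filter_upwards [(hmem n.1).coeFn_toLp, (hmem n.2).coeFn_toLp] with x h₁ h₂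
    simp [h₁, h₂]
  obtain ⟨g, hg⟩ := cauchySeq_tendsto_of_complete hcauchy
  refine ⟨g, Lp.memLp g, G, hG, u, hu, hlim, ?_⟩
  rw [Lp.tendsto_Lp_iff_tendsto_eLpNorm'] at hg
  refine tendsto_eLpNorm_zero_iff.1 (hg.congr fun n => eLpNorm_congr_ae ?_)
  filter_upwards [(hmem n).coeFn_toLp] with x h₁
  simp [h₁]

/-- The wall trace does not depend on the approximating sequence. -/
theorem IsWallTrace.tendsto {f₁ f₂ : ℝ → ℝ} (hf₁ : ContDiff ℝ ∞ f₁)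
    (hf₂ : ContDiff ℝ ∞ f₂) (hlt : ∀ t, f₁ t < f₂ t) {a b : ℝ} {v g : ℝ × ℝ → Vec}
    {G : ℝ × ℝ → Matrix (Fin 2) (Fin 2) ℝ} (hG : HasH1Grad (truncated f₁ f₂ a b) v G)
    (hg : IsWallTrace f₁ f₂ a b v g) {u : ℕ → ℝ × ℝ → Vec} (hu : ∀ n, ContDiff ℝ ∞ (u n))
    (hlim : TendstoH1 (truncated f₁ f₂ a b) u v G) :
    Tendsto (fun n => vecL2Sq (wallMeasure f₁ f₂ a b) (fun x => u n x - g x)) atTop (𝓝 0) := by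
  obtain ⟨C, hC, H⟩ := exists_vecL2Sq_wallMeasure_sub_le hf₁ hf₂ hlt a b
  obtain ⟨hgm, G', hG', w, hw, hlim', htr⟩ := hg
  obtain ⟨K, hK, hsub⟩ := exists_isCompact_superset_truncated hf₁.continuous hf₂.continuous a b
  -- The trace comes with its own weak gradient `G'` and sequence `w`; since `G' = G` almost
  -- everywhere, `w` and `u` approximate the same `H¹` field and can be compared on the walls.
  have hae := hG.ae_eq (isOpen_truncated hf₁.continuous hf₂.continuous a b)
    ((measure_mono hsub).trans_lt hK.measure_lt_top).ne hG'
  have hlim'' : TendstoH1 (truncated f₁ f₂ a b) w v G := by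
    refine hlim'.congr fun n => ?_
    rw [matL2Sq_congr_ae (A := fun x => grad (w n) x - G' x)
      (hae.mono fun x hx => show grad (w n) x - G' x = grad (w n) x - G x by rw [hx])]
  have hsum := ENNReal.Tendsto.const_mul (a := C) (hlim''.add hlim) (Or.inr hC)
  have htotal := ENNReal.Tendsto.const_mul (a := 2) (hsum.add htr) (Or.inr ENNReal.ofNat_ne_top)
  simp only [add_zero, mul_zero] at htotal
  refine tendsto_of_tendsto_of_tendsto_of_le_of_le tendsto_const_nhds htotal
    (fun n => zero_le) fun n => ?_
  have hswap : ∀ y z : ℝ × ℝ → Vec, vecL2Sq (wallMeasure f₁ f₂ a b) (fun x => y x - z x) =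
      vecL2Sq (wallMeasure f₁ f₂ a b) (fun x => z x - y x) := by
    intro y z
    refine lintegral_congr fun x => ?_
    rw [← enorm_neg, neg_sub]
  refine (vecL2Sq_sub_le (hu n).continuous.aestronglyMeasurable
    (hw n).continuous.aestronglyMeasurable).trans ?_
  rw [hswap (u n) (w n), hswap g (w n)]
  gcongr
  exact H _ _ v G (hw n) (hu n) hG

end SlipChannel

/-! ### Passage to the limit -/

theorem lemma2p3 (f₁ f₂ : ℝ → ℝ) (hf₁ : ContDiff ℝ ∞ f₁) (hf₂ : ContDiff ℝ ∞ f₂)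
    (hlt : ∀ t, f₁ t < f₂ t) (α : ℝ) (hα : 0 ≤ α) (a b : ℝ) (hab : a < b)
    (v : ℝ × ℝ → Vec) (hv : MemHSigma f₁ f₂ a b v) :
    (∃ g, IsWallTrace f₁ f₂ a b v g) ∧
    ∀ G g, HasH1Grad (truncated f₁ f₂ a b) v G → IsWallTrace f₁ f₂ a b v g →
      kornConst α f₁ f₂ * matL2Sq (truncated f₁ f₂ a b) G ≤
        2 * matL2Sq (truncated f₁ f₂ a b) (fun x => strain (G x)) +
          ENNReal.ofReal α * vecL2Sq (wallMeasure f₁ f₂ a b) g := by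
  obtain ⟨G', hG', u, hu, hlim⟩ := hv
  refine ⟨exists_isWallTrace hf₁ hf₂ hlt a b hG' (fun n => (hu n).smooth) hlim,
    fun G g hG hg => ?_⟩
  obtain ⟨K, hK, hsub⟩ := exists_isCompact_superset_truncated hf₁.continuous hf₂.continuous a b
  have hae := hG'.ae_eq (isOpen_truncated hf₁.continuous hf₂.continuous a b)
    ((measure_mono hsub).trans_lt hK.measure_lt_top).ne hG
  have hlimG : TendstoH1 (truncated f₁ f₂ a b) u v G := by
    refine hlim.congr fun n => ?_
    rw [matL2Sq_congr_ae (A := fun x => grad (u n) x - G' x)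
      (hae.mono fun x hx => show grad (u n) x - G' x = grad (u n) x - G x by rw [hx])]
  have hgrad : Tendsto (fun n => matL2Sq (truncated f₁ f₂ a b) fun x => grad (u n) x - G x)
      atTop (𝓝 0) :=
    tendsto_of_tendsto_of_tendsto_of_le_of_le tendsto_const_nhds hlimG (fun n => zero_le)
      fun n => le_add_self
  have hmeas : ∀ n i j, AEStronglyMeasurable (fun x => grad (u n) x i j)
      (volume.restrict (truncated f₁ f₂ a b)) := fun n i j =>
    (continuous_grad_apply (hu n).smooth i j).aestronglyMeasurable
  have hS := tendsto_matL2Sq hmeas hG.memLp_grad hgrad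
  have hT : Tendsto (fun n => matL2Sq (truncated f₁ f₂ a b) fun x => strain (grad (u n) x)) atTop
      (𝓝 (matL2Sq (truncated f₁ f₂ a b) fun x => strain (G x))) := by
    refine tendsto_matL2Sq (fun n i j => ?_) (fun i j => ?_)
      (tendsto_of_tendsto_of_tendsto_of_le_of_le tendsto_const_nhds hgrad (fun n => zero_le)
        fun n => matL2Sq_strain_sub_le _ _ _)
    · simp only [strain, Matrix.of_apply, div_eq_mul_inv]
      exact ((hmeas n i j).add (hmeas n j i)).mul_const _
    · simp only [strain, Matrix.of_apply, div_eq_mul_inv]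
      exact ((hG.memLp_grad i j).add (hG.memLp_grad j i)).mul_const _
  -- The trace `g` may have been built from another sequence, but `IsWallTrace.tendsto` shows that
  -- the solenoidal sequence `u` also converges to it on the walls.
  have hW := tendsto_lintegral_enorm_sq
    (fun n => (hu n).smooth.continuous.aestronglyMeasurable) hg.1
    (hg.tendsto hf₁ hf₂ hlt hG (fun n => (hu n).smooth) hlimG)
  have hκ : kornConst α f₁ f₂ ≠ ⊤ := ((kornConst_le_one α f₁ f₂).trans_lt ENNReal.one_lt_top).ne
  exact le_of_tendsto_of_tendsto' (ENNReal.Tendsto.const_mul hS (Or.inr hκ))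
    ((ENNReal.Tendsto.const_mul hT (Or.inr ENNReal.ofNat_ne_top)).add
      (ENNReal.Tendsto.const_mul hW (Or.inr ENNReal.ofReal_ne_top)))
    fun n => (hu n).kornConst_mul_le hf₁ hf₂ hlt α hab
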